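/- Let $X$ be a real Banach space that admits a $C^1$ smooth Lipschitz function $b : X \to \mathbb{R}$ with bounded non-empty support. Let $M$ be a connected paracompact (Hausdorff) $C^1$ manifold modeled on $X$, with a Finsler structure in the sense of Palais: a continuous map $\|\cdot\|_M : TM \to [0,\infty)$ whose restriction $\|\cdot\|_x$ to each $T_xM$ is a norm and such that, for every $C^1$ chart $\varphi : U \to X$, 1. for every $x \in U$ the norm $v \mapsto \|d\varphi^{-1}(\varphi(x))(v)\|_x$ is equivalent to the norm of $X$; 2. for every $x_0 \in U$ and $\varepsilon > 0$ there is an open neighborhood $W \subset U$ of $x_0$ such that $$\frac{1}{1+\varepsilon}\|d\varphi^{-1}(\varphi(x_0))(v)\|_{x_0} \le \|d\varphi^{-1}(\varphi(x))(v)\|_{x} \le (1+\varepsilon)\|d\varphi^{-1}(\varphi(x_0))(v)\|_{x_0} \qquad (x \in W,\ v \in X).$$ Let $d(p,q)$ be the infimum of the lengths $\int_a^b \|c'(t)\|_{c(t)}\,dt$ of the piecewise $C^1$ paths $c : [a,b] \to M$ from $p$ to $q$, and assume that $M$ is complete for the metric $d$. Let $\Omega \subset M$ be a non-empty open set that is bounded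 for $d$ and satisfies $\partial\Omega \neq \emptyset$. Then the eikonal problem $$\|du(x)\|_x = 1 \ \text{ for all } x \in \Omega, \qquad u(x) = 0 \ \text{ for all } x \in \partial\Omega,$$ where $\|\Delta\|_x = \sup\{|\Delta(\xi)| : \xi \in T_xM,\ \|\xi\|_x = 1\}$ is the dual norm on $T_xM^*$, has no classical solution, that is, there is no function $u : \overline{\Omega} \to \mathbb{R}$ that is continuous on $\overline{\Omega}$, Fréchet differentiable in $\Omega$, and satisfies both equations. -/

import Mathlib

open Set Filter Topology
open scoped Manifold ContDiff NNReal

noncomputable section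

/-- `X` admits a `C¹` Lipschitz bump function: a real function that is `C¹` smooth, Lipschitz, and
has bounded non-empty support. -/
def HasC1LipschitzBump (X : Type*) [NormedAddCommGroup X] [NormedSpace ℝ X] : Prop :=
  ∃ b : X → ℝ, ContDiff ℝ 1 b ∧ (∃ L : ℝ≥0, LipschitzWith L b) ∧
    (tsupport b).Nonempty ∧ Bornology.IsBounded (tsupport b)

section Finsler

variable {X : Type*} [NormedAddCommGroup X] [NormedSpace ℝ X]
  {M : Type*} [TopologicalSpace M] [ChartedSpace X M]

/-- The function `v ↦ ‖dφ⁻¹(φ x)(v)‖` on the model space, for a chart `φ` and a point `x` of its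
domain, where the tangent vector `dφ⁻¹(φ x)(v)` at `φ⁻¹ (φ x) = x` is measured by `N`. -/
def normInChart (N : ∀ x : M, Seminorm ℝ (TangentSpace 𝓘(ℝ, X) x))
    (φ : OpenPartialHomeomorph M X) (x : M) (v : X) : ℝ :=
  N (φ.symm (φ x)) (mfderiv 𝓘(ℝ, X) 𝓘(ℝ, X) φ.symm (φ x) v)

variable (X M) in
/-- A Finsler structure in the sense of Palais on a `C¹` manifold `M` modeled on `X`. -/
structure FinslerStructure [IsManifold 𝓘(ℝ, X) 1 M] where
  /-- The function `‖·‖_x` on `T_x M`; with `eq_zero_of_norm` it is a norm. -/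
  norm : ∀ x : M, Seminorm ℝ (TangentSpace 𝓘(ℝ, X) x)
  eq_zero_of_norm : ∀ (x : M) (v : TangentSpace 𝓘(ℝ, X) x), norm x v = 0 → v = 0
  continuous_norm : Continuous fun p : TangentBundle 𝓘(ℝ, X) M => norm p.1 p.2
  /-- In every chart, the norm of each tangent space is equivalent to the norm of `X`. -/
  equivalent : ∀ φ ∈ IsManifold.maximalAtlas 𝓘(ℝ, X) 1 M, ∀ x ∈ φ.source,
    ∃ K : ℝ, 1 ≤ K ∧ ∀ v : X,
      1 / K * ‖v‖ ≤ normInChart norm φ x v ∧ normInChart norm φ x v ≤ K * ‖v‖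
  /-- In every chart, the norms of nearby tangent spaces are `(1 + ε)`-equivalent. -/
  palais : ∀ φ ∈ IsManifold.maximalAtlas 𝓘(ℝ, X) 1 M, ∀ x₀ ∈ φ.source, ∀ ε : ℝ, 0 < ε →
    ∃ W : Set M, IsOpen W ∧ x₀ ∈ W ∧ W ⊆ φ.source ∧ ∀ x ∈ W, ∀ v : X,
      1 / (1 + ε) * normInChart norm φ x₀ v ≤ normInChart norm φ x v ∧
        normInChart norm φ x v ≤ (1 + ε) * normInChart norm φ x₀ v

variable (X) in
/-- The restriction of `c` to `[a, b]` is a piecewise `C¹` smooth path: there is a finite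
subdivision `a = t 0 ≤ t 1 ≤ ⋯ ≤ t n = b` such that `c` is `C¹` on every closed interval
`[t i, t (i + 1)]`. (In particular `c` is continuous on `[a, b]`.) -/
def IsPiecewiseC1 (c : ℝ → M) (a b : ℝ) : Prop :=
  ∃ (n : ℕ) (t : ℕ → ℝ), Monotone t ∧ t 0 = a ∧ t n = b ∧
    ∀ i < n, ContMDiffOn 𝓘(ℝ, ℝ) 𝓘(ℝ, X) 1 c (Icc (t i) (t (i + 1)))

namespace FinslerStructure

variable [IsManifold 𝓘(ℝ, X) 1 M] (F : FinslerStructure X M)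

/-- The length `∫_a^b ‖c'(t)‖_{c(t)} dt`. For a piecewise `C¹` path on `[a, b]` the derivative
exists at all but finitely many points of `[a, b]`. -/
def length (c : ℝ → M) (a b : ℝ) : ℝ :=
  ∫ t in a..b, F.norm (c t) (mfderiv 𝓘(ℝ, ℝ) 𝓘(ℝ, X) c t (1 : ℝ))

/-- The Finsler metric: the infimum of the lengths of the piecewise `C¹` paths from `p` to `q`. -/
def dist (p q : M) : ℝ :=
  sInf {L : ℝ | ∃ (a b : ℝ) (c : ℝ → M), a ≤ b ∧ IsPiecewiseC1 X c a b ∧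
    c a = p ∧ c b = q ∧ L = F.length c a b}

/-- Completeness for the Finsler metric: Cauchy sequences converge. -/
def IsCompleteMetric : Prop :=
  ∀ p : ℕ → M,
    (∀ ε : ℝ, 0 < ε → ∃ n₀ : ℕ, ∀ m ≥ n₀, ∀ n ≥ n₀, F.dist (p m) (p n) < ε) →
      ∃ x : M, Tendsto (fun n => F.dist (p n) x) atTop (𝓝 0)

/-- Boundedness for the Finsler metric. -/
def IsBoundedSet (S : Set M) : Prop :=
  ∃ R : ℝ, ∀ x ∈ S, ∀ y ∈ S, F.dist x y ≤ R

/-- The dual norm `sup {|Δ ξ| : ‖ξ‖_x = 1}` on the cotangent space `T_x M^*`. -/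
def dualNorm (x : M) (Δ : TangentSpace 𝓘(ℝ, X) x →L[ℝ] ℝ) : ℝ :=
  sSup {r : ℝ | ∃ ξ : TangentSpace 𝓘(ℝ, X) x, F.norm x ξ = 1 ∧ r = |Δ ξ|}

/-- Classical solutions of `‖du(x)‖_x = 1` in the open set `Ω`, `u = 0` on `∂Ω`: functions that are
continuous on the closure of `Ω`, Fréchet differentiable in `Ω`, and satisfy both equations. Only
the values of `u` on the closure of `Ω` matter. -/
structure IsClassicalEikonalSolution (Ω : Set M) (u : M → ℝ) : Prop where
  continuousOn : ContinuousOn u (closure Ω)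
  differentiable : ∀ x ∈ Ω, MDifferentiableAt 𝓘(ℝ, X) 𝓘(ℝ, ℝ) u x
  eikonal : ∀ x ∈ Ω, F.dualNorm x (mfderiv 𝓘(ℝ, X) 𝓘(ℝ, ℝ) u x) = 1
  boundary : ∀ x ∈ frontier Ω, u x = 0

end FinslerStructure

end Finsler

end

/-! Any solution u would vanish on Ω: one shows u ≤ 0, and -u is again a solution. Then du = 0 on Ω
and its dual norm is not 1.

Suppose u > 0 somewhere. Closed bounded sets need not be compact, so u may have no maximum.
Ekeland's principle (`exists_ekeland_point`) on the closure of Ω replaces it by a point z with u(z)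
> 0 and u(y) ≤ u(z) + d(z,y)/2 for all y. Since u = 0 on ∂Ω, z lies in Ω. Comparing u along short
chart segments from z (`mfderiv_apply_le`) gives ‖du(z)‖ ≤ 3/4, a contradiction.

Ekeland's principle needs two inputs. The function u is bounded above: a path from a point of Ω to a
fixed boundary point first leaves Ω where u = 0, and u varies before that by at most the length
(`HasPath.exists_mem_frontier`). And d-limits are limits in M, so they stay in the closure and u is
continuous along them: the same exit argument, applied to a chart, gives `exists_dist_lt_imp_mem`.
-/

namespace FinslerStructure

/-! ### Speed of paths -/

variable {X : Type*} [NormedAddCommGroup X] [NormedSpace ℝ X]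
  {M : Type*} [TopologicalSpace M] [ChartedSpace X M] [IsManifold 𝓘(ℝ, X) 1 M]
  (F : FinslerStructure X M)

/-- The speed `‖c'(t)‖_{c(t)}` of a path. -/
noncomputable def speed (c : ℝ → M) (t : ℝ) : ℝ :=
  F.norm (c t) (mfderiv 𝓘(ℝ, ℝ) 𝓘(ℝ, X) c t (1 : ℝ))

theorem length_eq (c : ℝ → M) (a b : ℝ) : F.length c a b = ∫ t in a..b, F.speed c t := rfl

theorem speed_nonneg (c : ℝ → M) (t : ℝ) : 0 ≤ F.speed c t := apply_nonneg _ _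

theorem length_nonneg (c : ℝ → M) {a b : ℝ} (hab : a ≤ b) : 0 ≤ F.length c a b :=
  intervalIntegral.integral_nonneg hab fun t _ => F.speed_nonneg c t

theorem norm_congr {x y : M} (h : x = y) (v : X) :
    F.norm x v = F.norm y v := by
  subst h; rfl

theorem speed_congr {c c' : ℝ → M} {t : ℝ} (h : c =ᶠ[𝓝 t] c') :
    F.speed c t = F.speed c' t := by
  unfold speed
  rw [h.mfderiv_eq]
  exact F.norm_congr h.self_of_nhds _

theorem speed_comp {c : ℝ → M} {h : ℝ → ℝ} {σ t : ℝ} (hh : HasDerivAt h σ t) (hσ : |σ| = 1)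
    (hc : MDifferentiableAt 𝓘(ℝ, ℝ) 𝓘(ℝ, X) c (h t)) :
    F.speed (c ∘ h) t = F.speed c (h t) := by
  unfold speed
  rw [mfderiv_comp t hc hh.differentiableAt.mdifferentiableAt, mfderiv_eq_fderiv]
  have h1 : (fderiv ℝ h t : ℝ →L[ℝ] ℝ) 1 = σ • (1 : ℝ) := by simp [hh.deriv]
  change F.norm (c (h t)) ((mfderiv 𝓘(ℝ, ℝ) 𝓘(ℝ, X) c (h t)) ((fderiv ℝ h t : ℝ →L[ℝ] ℝ) 1)) = _
  rw [h1]
  refine (congrArg _ (ContinuousLinearMap.map_smul _ σ _)).trans ?_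
  rw [map_smul_eq_mul, Real.norm_eq_abs, hσ, one_mul]

/-- Endpoints are excluded because `speed` uses the two-sided derivative, which gluing can change
there. -/
theorem intervalIntegral_congr_Ioo {f g : ℝ → ℝ} {a b : ℝ} (hab : a ≤ b)
    (h : ∀ t ∈ Ioo a b, f t = g t) : ∫ t in a..b, f t = ∫ t in a..b, g t := by
  rw [intervalIntegral.integral_of_le hab, intervalIntegral.integral_of_le hab,
    MeasureTheory.integral_Ioc_eq_integral_Ioo, MeasureTheory.integral_Ioc_eq_integral_Ioo]
  exact MeasureTheory.setIntegral_congr_fun measurableSet_Ioo h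

/-- The derivative within `Icc a b` gives a speed continuous up to the endpoints; it agrees with
`speed` in the interior. -/
theorem integrableOn_speed {c : ℝ → M} {a b : ℝ} (hab : a < b)
    (hc : ContMDiffOn 𝓘(ℝ, ℝ) 𝓘(ℝ, X) 1 c (Icc a b)) :
    MeasureTheory.IntegrableOn (F.speed c) (Icc a b) := by
  have hu : UniqueMDiffOn 𝓘(ℝ, ℝ) (Icc a b) := (uniqueDiffOn_Icc hab).uniqueMDiffOn
  have h1 := hc.continuousOn_tangentMapWithin le_rfl hu
  have h2 : Continuous fun t : ℝ => (⟨t, (1 : ℝ)⟩ : TangentBundle 𝓘(ℝ, ℝ) ℝ) := by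
    have := (tangentBundleModelSpaceHomeomorph 𝓘(ℝ, ℝ)).symm.continuous
    exact this.comp (f := fun t : ℝ => ((t, (1 : ℝ)) : ModelProd ℝ ℝ))
      (continuous_id.prodMk continuous_const)
  have h3 : ContinuousOn (fun t : ℝ => F.norm (c t)
      (mfderivWithin 𝓘(ℝ, ℝ) 𝓘(ℝ, X) c (Icc a b) t (1 : ℝ))) (Icc a b) :=
    F.continuous_norm.comp_continuousOn (h1.comp h2.continuousOn fun t ht => ht)
  rw [integrableOn_Icc_iff_integrableOn_Ioo]
  refine ((h3.integrableOn_Icc).mono_set Ioo_subset_Icc_self).congr_fun ?_ measurableSet_Ioo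
  intro t ht
  simp only [speed]
  rw [mfderivWithin_of_mem_nhds (Icc_mem_nhds ht.1 ht.2)]

end FinslerStructure

/-! ### Concatenation and reversal of paths; the Finsler distance -/

namespace FinslerStructure

variable {X : Type*} [NormedAddCommGroup X] [NormedSpace ℝ X]
  {M : Type*} [TopologicalSpace M] [ChartedSpace X M] [IsManifold 𝓘(ℝ, X) 1 M]
  (F : FinslerStructure X M)

/-- There is a piecewise `C¹` path of length `L` from `p` to `q`. -/
def HasPath (p q : M) (L : ℝ) : Prop :=
  ∃ (a b : ℝ) (c : ℝ → M), a ≤ b ∧ IsPiecewiseC1 X c a b ∧ c a = p ∧ c b = q ∧ L = F.length c a b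

/-- There is a `C¹` path of length `L` from `p` to `q`, defined on a nontrivial interval. -/
def HasArc (p q : M) (L : ℝ) : Prop :=
  ∃ (a b : ℝ) (c : ℝ → M), a < b ∧ ContMDiffOn 𝓘(ℝ, ℝ) 𝓘(ℝ, X) 1 c (Icc a b) ∧
    c a = p ∧ c b = q ∧ L = F.length c a b

theorem dist_eq (p q : M) : F.dist p q = sInf {L : ℝ | F.HasPath p q L} := rfl

theorem intervalIntegrable_speed_of_contMDiffOn {c : ℝ → M} {a b : ℝ} (hab : a ≤ b)
    (hc : ContMDiffOn 𝓘(ℝ, ℝ) 𝓘(ℝ, X) 1 c (Icc a b)) :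
    IntervalIntegrable (F.speed c) MeasureTheory.volume a b := by
  rcases hab.eq_or_lt with rfl | h
  · simp
  · exact (intervalIntegrable_iff_integrableOn_Icc_of_le hab).2 (F.integrableOn_speed h hc)

theorem intervalIntegrable_speed {c : ℝ → M} {a b : ℝ} (hc : IsPiecewiseC1 X c a b) :
    IntervalIntegrable (F.speed c) MeasureTheory.volume a b := by
  obtain ⟨n, t, ht, rfl, rfl, h⟩ := hc
  exact IntervalIntegrable.trans_iterate fun i hi =>
    F.intervalIntegrable_speed_of_contMDiffOn (ht i.le_succ) (h i hi)

theorem HasPath.nonneg {p q : M} {L : ℝ} (h : F.HasPath p q L) : 0 ≤ L := by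
  obtain ⟨a, b, c, hab, -, -, -, rfl⟩ := h
  exact F.length_nonneg c hab

theorem HasPath.refl (p : M) : F.HasPath p p 0 :=
  ⟨0, 0, fun _ => p, le_rfl, ⟨0, fun _ => 0, monotone_const, rfl, rfl, by simp⟩, rfl, rfl,
    by simp [length_eq]⟩

/-- A reflexive and transitive relation that holds along `C¹` paths holds along piecewise `C¹`
paths. -/
theorem HasPath.induction {Q : M → M → ℝ → Prop} (hrefl : ∀ x, Q x x 0)
    (htrans : ∀ x y z L L', Q x y L → Q y z L' → Q x z (L + L'))
    (harc : ∀ x y L, F.HasArc x y L → Q x y L) {p q : M} {L : ℝ} (h : F.HasPath p q L) :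
    Q p q L := by
  obtain ⟨a, b, c, hab, ⟨n, t, ht, rfl, rfl, hc⟩, rfl, rfl, rfl⟩ := h
  have key : ∀ m ≤ n, Q (c (t 0)) (c (t m)) (F.length c (t 0) (t m)) := by
    intro m
    induction m with
    | zero => intro _; simpa [length_eq] using hrefl (c (t 0))
    | succ m ih =>
      intro hm
      have h1 := ih (Nat.le_of_succ_le hm)
      have hI : ∀ i < n, IntervalIntegrable (F.speed c) MeasureTheory.volume (t i) (t (i + 1)) :=
        fun i hi => F.intervalIntegrable_speed_of_contMDiffOn (ht i.le_succ) (hc i hi)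
      have h2 : F.length c (t 0) (t (m + 1)) =
          F.length c (t 0) (t m) + F.length c (t m) (t (m + 1)) := by
        simp only [length_eq]
        exact (intervalIntegral.integral_add_adjacent_intervals
          (IntervalIntegrable.trans_iterate fun i hi => hI i (by omega)) (hI m hm)).symm
      rw [h2]
      refine htrans _ _ _ _ _ h1 ?_
      rcases (ht m.le_succ).eq_or_lt with h | h
      · rw [← Nat.succ_eq_add_one, ← h]
        simpa [length_eq] using hrefl (c (t m))
      · exact harc _ _ _ ⟨_, _, c, h, hc m hm, rfl, rfl, rfl⟩
  exact key n le_rfl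

/-- Gluing a single arc in front only adds one node to the subdivision; general concatenation then
follows by induction. -/
theorem HasPath.prepend {x y z : M} {L L' : ℝ} (h : F.HasArc x y L) (h' : F.HasPath y z L') :
    F.HasPath x z (L + L') := by
  obtain ⟨α, β, c₀, hαβ, hc₀, rfl, rfl, rfl⟩ := h
  obtain ⟨a, b, c, hab, hc, hca, rfl, rfl⟩ := h'
  have hI := F.intervalIntegrable_speed hc
  obtain ⟨n, t, ht, rfl, rfl, hc⟩ := hc
  set a := t 0
  set b := t n
  set a' := a - (β - α) with ha'
  set s : ℝ → ℝ := fun r => r - a + β with hs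
  have hsd : ∀ r, HasDerivAt s 1 r := fun r => ((hasDerivAt_id r).sub_const a).add_const β
  have haa : a' < a := by rw [ha']; linarith
  have hsm : MapsTo s (Icc a' a) (Icc α β) := by
    intro r hr
    simp only [hs, ha', mem_Icc] at hr ⊢
    constructor <;> linarith [hr.1, hr.2]
  -- `s` translates `[a', a]` onto `[α, β]`. At `a` both formulas give `y`, so `C` is `C¹` on each
  -- closed piece.
  set C : ℝ → M := fun r => if r < a then c₀ (s r) else c r with hC
  have hC0 : ∀ r ∈ Icc a' a, C r = (c₀ ∘ s) r := by
    intro r hr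
    rcases hr.2.eq_or_lt with rfl | h
    · simp [hC, hs, hca]
    · simp [hC, h]
  have hC1 : ∀ r, a ≤ r → C r = c r := fun r hr => by simp [hC, hr.not_gt]
  have hd0 : ContMDiffOn 𝓘(ℝ, ℝ) 𝓘(ℝ, X) 1 C (Icc a' a) := by
    refine ContMDiffOn.congr (hc₀.comp ?_ hsm) hC0
    rw [contMDiffOn_iff_contDiffOn]
    exact (by fun_prop : ContDiff ℝ 1 s).contDiffOn
  have hl0 : F.length C a' a = F.length c₀ α β := by
    have e1 : F.length C a' a = ∫ r in a'..a, F.speed c₀ (r + (β - a)) := by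
      refine intervalIntegral_congr_Ioo haa.le fun r hr => ?_
      have hs' : s r = r + (β - a) := by simp only [hs]; ring
      rw [← hs', ← F.speed_comp (hsd r) abs_one]
      · refine F.speed_congr ?_
        filter_upwards [Icc_mem_nhds hr.1 hr.2] with r' hr' using hC0 r' hr'
      · have : s r ∈ Ioo α β := by
          simp only [hs, ha', mem_Ioo] at hr ⊢
          constructor <;> linarith [hr.1, hr.2]
        exact (hc₀.contMDiffAt (Icc_mem_nhds this.1 this.2)).mdifferentiableAt one_ne_zero
    rw [e1, intervalIntegral.integral_comp_add_right]
    simp only [length_eq, ha']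
    congr 1 <;> ring
  have hsp : ∀ r ∈ Ioo a b, F.speed c r = F.speed C r := by
    intro r hr
    refine F.speed_congr ?_
    filter_upwards [Ioi_mem_nhds hr.1] with r' hr' using (hC1 r' (le_of_lt hr')).symm
  have hl1 : F.length C a b = F.length c a b :=
    (intervalIntegral_congr_Ioo hab hsp).symm
  have hI1 : IntervalIntegrable (F.speed C) MeasureTheory.volume a b := by
    rw [intervalIntegrable_iff_integrableOn_Ioo_of_le hab] at hI ⊢
    exact hI.congr_fun hsp measurableSet_Ioo
  refine ⟨a', b, C, haa.le.trans hab, ⟨n + 1, fun i => Nat.casesOn i a' t, ?_, rfl, rfl, ?_⟩,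
    ?_, hC1 b hab, ?_⟩
  · refine monotone_nat_of_le_succ fun i => ?_
    cases i with
    | zero => exact haa.le
    | succ i => exact ht i.le_succ
  · intro i hi
    cases i with
    | zero => exact hd0
    | succ i =>
      refine (hc i (by omega)).congr fun r hr => hC1 r ((ht (Nat.zero_le i)).trans hr.1)
  · rw [hC0 a' ⟨le_rfl, haa.le⟩]
    simp [hs, ha']
  · rw [← hl0, ← hl1]
    simp only [length_eq]
    exact intervalIntegral.integral_add_adjacent_intervals
      (F.intervalIntegrable_speed_of_contMDiffOn haa.le hd0) hI1

theorem HasPath.trans {x y z : M} {L L' : ℝ} (h : F.HasPath x y L) (h' : F.HasPath y z L') :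
    F.HasPath x z (L + L') := by
  -- Quantifying over all continuations makes the relation transitive.
  refine HasPath.induction F (Q := fun x y L => ∀ z L', F.HasPath y z L' → F.HasPath x z (L + L'))
    ?_ ?_ ?_ h z L' h'
  · intro x z L' h; rwa [zero_add]
  · intro x y z L L' h h' w L'' h''
    rw [add_assoc]
    exact h _ _ (h' _ _ h'')
  · intro x y L h z L' h'
    exact HasPath.prepend F h h'

theorem HasArc.hasPath {x y : M} {L : ℝ} (h : F.HasArc x y L) : F.HasPath x y L := by
  simpa using HasPath.prepend F h (HasPath.refl F y)

theorem HasArc.symm {x y : M} {L : ℝ} (h : F.HasArc x y L) : F.HasArc y x L := by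
  obtain ⟨a, b, c, hab, hc, rfl, rfl, rfl⟩ := h
  refine ⟨-b, -a, c ∘ Neg.neg, neg_lt_neg hab, hc.comp ?_ ?_, by simp, by simp, ?_⟩
  · rw [contMDiffOn_iff_contDiffOn]
    exact contDiff_neg.contDiffOn
  · intro r hr
    simp only [mem_Icc] at hr ⊢
    constructor <;> linarith [hr.1, hr.2]
  · have e1 : F.length (c ∘ Neg.neg) (-b) (-a) = ∫ r in (-b)..(-a), F.speed c (-r) := by
      refine intervalIntegral_congr_Ioo (neg_le_neg hab.le) fun r hr => ?_
      refine F.speed_comp (h := fun r : ℝ => -r) (hasDerivAt_neg r) (by simp) ?_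
      exact (hc.contMDiffAt (Icc_mem_nhds (by linarith [hr.2]) (by linarith [hr.1]))).mdifferentiableAt
        one_ne_zero
    rw [e1, intervalIntegral.integral_comp_neg, neg_neg, neg_neg]
    rfl

theorem HasPath.symm {x y : M} {L : ℝ} (h : F.HasPath x y L) : F.HasPath y x L := by
  refine HasPath.induction F (Q := fun x y L => F.HasPath y x L) (HasPath.refl F) ?_ ?_ h
  · intro x y z L L' h h'
    rw [add_comm]
    exact h'.trans F h
  · intro x y L h
    exact (h.symm F).hasPath F

theorem dist_nonneg (p q : M) : 0 ≤ F.dist p q :=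
  Real.sInf_nonneg fun _ h => HasPath.nonneg F h

theorem dist_le_of_hasPath {p q : M} {L : ℝ} (h : F.HasPath p q L) : F.dist p q ≤ L :=
  csInf_le ⟨0, fun _ h => HasPath.nonneg F h⟩ h

theorem dist_self (p : M) : F.dist p p = 0 :=
  le_antisymm (F.dist_le_of_hasPath (HasPath.refl F p)) (F.dist_nonneg p p)

theorem dist_comm (p q : M) : F.dist p q = F.dist q p := by
  rw [dist_eq, dist_eq]
  congr 1
  ext L
  exact ⟨fun h => HasPath.symm F h, fun h => HasPath.symm F h⟩

end FinslerStructure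

/-! ### Mean value inequality, exit points, chart segments -/

namespace FinslerStructure

variable {X : Type*} [NormedAddCommGroup X] [NormedSpace ℝ X]
  {M : Type*} [TopologicalSpace M] [ChartedSpace X M] [IsManifold 𝓘(ℝ, X) 1 M]
  (F : FinslerStructure X M) {E : Type*} [NormedAddCommGroup E] [NormedSpace ℝ E]

/-- The mean value inequality along a `C¹` path. -/
theorem norm_sub_le_length {c : ℝ → M} {a b s : ℝ} (has : a ≤ s) (hsb : s ≤ b)
    (hc : ContMDiffOn 𝓘(ℝ, ℝ) 𝓘(ℝ, X) 1 c (Icc a b)) {f : M → E} {C : ℝ} (hC : 0 ≤ C)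
    (hcont : ContinuousOn (f ∘ c) (Icc a s))
    (hd : ∀ t ∈ Ioo a s, MDifferentiableAt 𝓘(ℝ, X) 𝓘(ℝ, E) f (c t))
    (hb : ∀ t ∈ Ioo a s, ∀ ξ : TangentSpace 𝓘(ℝ, X) (c t),
      Norm.norm (E := E) (mfderiv 𝓘(ℝ, X) 𝓘(ℝ, E) f (c t) ξ) ≤ C * F.norm (c t) ξ) :
    ‖f (c s) - f (c a)‖ ≤ C * F.length c a b := by
  have hle : F.length c a s ≤ F.length c a b := by
    have h1 := F.intervalIntegrable_speed_of_contMDiffOn has (hc.mono (Icc_subset_Icc_right hsb))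
    have h2 := F.intervalIntegrable_speed_of_contMDiffOn hsb (hc.mono (Icc_subset_Icc_left has))
    have h3 := intervalIntegral.integral_add_adjacent_intervals h1 h2
    have h4 := F.length_nonneg c hsb
    simp only [length_eq] at h4 ⊢
    linarith
  refine le_trans ?_ (mul_le_mul_of_nonneg_left hle hC)
  rcases has.eq_or_lt with rfl | has
  · simp [length_eq]
  -- A norming functional reduces to a real function, whose right derivative only needs an
  -- integrable upper bound; `f` need not be `C¹`.
  obtain ⟨g, hg1, hg⟩ := exists_dual_vector'' ℝ (f (c s) - f (c a))
  have hg' : g (f (c s)) - g (f (c a)) = ‖f (c s) - f (c a)‖ := by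
    rw [← map_sub]; exact hg
  rw [← hg', length_eq, ← intervalIntegral.integral_const_mul]
  refine intervalIntegral.sub_le_integral_of_hasDeriv_right_of_le (g := fun t => g (f (c t)))
    (g' := fun t => g (mfderiv 𝓘(ℝ, X) 𝓘(ℝ, E) f (c t)
      (mfderiv 𝓘(ℝ, ℝ) 𝓘(ℝ, X) c t (1 : ℝ)))) has.le
    (g.continuous.comp_continuousOn hcont) ?_ ?_ ?_
  · intro t ht
    have hct : MDifferentiableAt 𝓘(ℝ, ℝ) 𝓘(ℝ, X) c t :=
      (hc.contMDiffAt (Icc_mem_nhds ht.1 (ht.2.trans_le hsb))).mdifferentiableAt one_ne_zero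
    have h1 := ((hd t ht).hasMFDerivAt.comp t hct.hasMFDerivAt).hasFDerivAt
    have h2 := (g.hasFDerivAt.comp t h1).hasDerivAt
    exact h2.hasDerivWithinAt
  · exact (F.integrableOn_speed has (hc.mono (Icc_subset_Icc_right hsb))).const_mul C
  · intro t ht
    refine (le_abs_self _).trans ((g.le_opNorm _).trans ?_)
    refine (mul_le_of_le_one_left (norm_nonneg _) hg1).trans ?_
    exact hb t ht _

/-- A path leaving an open set `U` crosses the frontier of `U` at a point where a function that is
`C`-Lipschitz infinitesimally on `U` has varied by at most `C` times the length of the path. -/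
theorem HasPath.exists_mem_frontier {U : Set M} (hU : IsOpen U) {f : M → E}
    (hf : ContinuousOn f (closure U)) (hd : ∀ x ∈ U, MDifferentiableAt 𝓘(ℝ, X) 𝓘(ℝ, E) f x)
    {C : ℝ} (hC : 0 ≤ C) (hb : ∀ x ∈ U, ∀ ξ : TangentSpace 𝓘(ℝ, X) x,
      Norm.norm (E := E) (mfderiv 𝓘(ℝ, X) 𝓘(ℝ, E) f x ξ) ≤ C * F.norm x ξ)
    {x y : M} {L : ℝ} (h : F.HasPath x y L) (hx : x ∈ U) (hy : y ∉ U) :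
    ∃ w ∈ frontier U, ‖f w - f x‖ ≤ C * L := by
  -- Invariant under concatenation: either the path is still in `U`, or a frontier point has been
  -- met. `0 ≤ L` lets the bound at that point survive lengthening.
  have key : 0 ≤ L ∧ (x ∈ U → (y ∈ U ∧ ‖f y - f x‖ ≤ C * L) ∨
      ∃ w ∈ frontier U, ‖f w - f x‖ ≤ C * L) := by
    refine HasPath.induction F (Q := fun x y L => 0 ≤ L ∧
      (x ∈ U → (y ∈ U ∧ ‖f y - f x‖ ≤ C * L) ∨
        ∃ w ∈ frontier U, ‖f w - f x‖ ≤ C * L)) ?_ ?_ ?_ h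
    · exact fun x => ⟨le_rfl, fun hx => Or.inl ⟨hx, by simp⟩⟩
    · rintro x y z L L' ⟨hL, h⟩ ⟨hL', h'⟩
      refine ⟨add_nonneg hL hL', fun hx => ?_⟩
      rcases h hx with ⟨hy, h1⟩ | ⟨w, hw, h1⟩
      · have tri : ∀ w, ‖f w - f y‖ ≤ C * L' → ‖f w - f x‖ ≤ C * (L + L') := fun w hw => by
          have := norm_sub_le_norm_sub_add_norm_sub (f w) (f y) (f x)
          linarith
        rcases h' hy with ⟨hz, h2⟩ | ⟨w, hw, h2⟩
        · exact Or.inl ⟨hz, tri _ h2⟩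
        · exact Or.inr ⟨w, hw, tri _ h2⟩
      · refine Or.inr ⟨w, hw, h1.trans (mul_le_mul_of_nonneg_left (by linarith) hC)⟩
    · rintro x y L ⟨a, b, c, hab, hc, rfl, rfl, rfl⟩
      refine ⟨F.length_nonneg c hab.le, fun hx => ?_⟩
      by_cases hall : ∀ t ∈ Icc a b, c t ∈ U
      · refine Or.inl ⟨hall b ⟨hab.le, le_rfl⟩, ?_⟩
        refine F.norm_sub_le_length hab.le le_rfl hc hC ?_ ?_ ?_
        · exact hf.comp hc.continuousOn fun t ht => subset_closure (hall t ht)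
        · exact fun t ht => hd _ (hall t (Ioo_subset_Icc_self ht))
        · exact fun t ht => hb _ (hall t (Ioo_subset_Icc_self ht))
      · push Not at hall
        -- `s = sInf S` is the first exit time: before it the path lies in `U`, so up to it the path
        -- lies in the closure, where `f` is continuous.
        set S : Set ℝ := Icc a b ∩ c ⁻¹' Uᶜ with hS
        have hSc : IsClosed S :=
          hc.continuousOn.preimage_isClosed_of_isClosed isClosed_Icc hU.isClosed_compl
        have hSne : S.Nonempty := hall
        have hSb : BddBelow S := ⟨a, fun t ht => ht.1.1⟩
        set s := sInf S
        have hs : s ∈ S := hSc.csInf_mem hSne hSb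
        have has : a < s := by
          refine hs.1.1.lt_of_ne fun h => ?_
          exact hs.2 (h ▸ hx)
        have hlt : ∀ t ∈ Ico a s, c t ∈ U := fun t ht => by
          by_contra hn
          exact (csInf_le hSb ⟨⟨ht.1, ht.2.le.trans hs.1.2⟩, hn⟩).not_gt ht.2
        have hcl : ∀ t ∈ Icc a s, c t ∈ closure U := by
          have h1 : closure (Ico a s) = Icc a s := closure_Ico has.ne
          have h2 : ContinuousOn c (closure (Ico a s)) := by
            rw [h1]; exact hc.continuousOn.mono (Icc_subset_Icc_right hs.1.2)
          intro t ht
          rw [← h1] at ht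
          exact closure_mono (image_subset_iff.2 hlt) (h2.image_closure (mem_image_of_mem c ht))
        refine Or.inr ⟨c s, ⟨hcl s ⟨has.le, le_rfl⟩, ?_⟩, ?_⟩
        · rw [hU.interior_eq]; exact hs.2
        · refine F.norm_sub_le_length has.le hs.1.2 hc hC ?_ ?_ ?_
          · exact hf.comp (hc.continuousOn.mono (Icc_subset_Icc_right hs.1.2)) hcl
          · exact fun t ht => hd _ (hlt t (Ioo_subset_Ico_self ht))
          · exact fun t ht => hb _ (hlt t (Ioo_subset_Ico_self ht))
  rcases key.2 hx with ⟨h, -⟩ | h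
  · exact absurd h hy
  · exact h

/-- The Finsler norm of a tangent vector, computed in a chart. -/
theorem norm_eq_normInChart {φ : OpenPartialHomeomorph M X}
    (hφ : φ ∈ IsManifold.maximalAtlas 𝓘(ℝ, X) 1 M) {x : M} (hx : x ∈ φ.source)
    (ξ : TangentSpace 𝓘(ℝ, X) x) :
    normInChart F.norm φ x (mfderiv 𝓘(ℝ, X) 𝓘(ℝ, X) φ x ξ) = F.norm x ξ := by
  have hd : φ.MDifferentiable 𝓘(ℝ, X) 𝓘(ℝ, X) :=
    ⟨(contMDiffOn_of_mem_maximalAtlas hφ).mdifferentiableOn one_ne_zero,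
      (contMDiffOn_symm_of_mem_maximalAtlas hφ).mdifferentiableOn one_ne_zero⟩
  have h := DFunLike.congr_fun (hd.symm_comp_deriv hx) ξ
  refine (F.norm_congr (φ.left_inv hx) _).trans ?_
  exact congrArg (F.norm x) h

/-- Nearby points are joined by straight segments in a chart. -/
theorem exists_hasArc_chart {φ : OpenPartialHomeomorph M X}
    (hφ : φ ∈ IsManifold.maximalAtlas 𝓘(ℝ, X) 1 M) {z : M} (hz : z ∈ φ.source)
    {ε : ℝ} (hε : 0 < ε) :
    ∃ r > 0, Metric.ball (φ z) r ⊆ φ.target ∧ ∀ p ∈ Metric.ball (φ z) r,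
      ∀ q ∈ Metric.ball (φ z) r, ∃ L, F.HasArc (φ.symm p) (φ.symm q) L ∧
        L ≤ (1 + ε) * normInChart F.norm φ z (q - p) := by
  obtain ⟨W, hW, hzW, hWs, hWb⟩ := F.palais φ hφ z hz ε hε
  have hn : φ.target ∩ φ.symm ⁻¹' W ∈ 𝓝 (φ z) :=
    (φ.symm.isOpen_inter_preimage hW).mem_nhds ⟨φ.map_source hz, by simpa [φ.left_inv hz] using hzW⟩
  obtain ⟨r, hr, hball⟩ := Metric.mem_nhds_iff.1 hn
  refine ⟨r, hr, fun p hp => (hball hp).1, fun p hp q hq => ?_⟩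
  set l : ℝ → X := fun t => p + t • (q - p) with hl
  have hlb : ∀ t ∈ Icc (0 : ℝ) 1, l t ∈ Metric.ball (φ z) r := by
    intro t ht
    exact (convex_ball (φ z) r).add_smul_sub_mem hp hq ht
  have hlc : ContDiff ℝ 1 l := by fun_prop
  have hld : ∀ t, HasDerivAt l (q - p) t := fun t => by
    simpa [hl] using ((hasDerivAt_id t).smul_const (q - p)).const_add p
  refine ⟨F.length (φ.symm ∘ l) 0 1, ⟨0, 1, φ.symm ∘ l, zero_lt_one, ?_, by simp [hl],
    by simp [hl], rfl⟩, ?_⟩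
  · refine (contMDiffOn_symm_of_mem_maximalAtlas hφ).comp ?_ fun t ht => (hball (hlb t ht)).1
    rw [contMDiffOn_iff_contDiffOn]
    exact hlc.contDiffOn
  · have hsp : ∀ t ∈ Ioc (0 : ℝ) 1,
        ‖F.speed (φ.symm ∘ l) t‖ ≤ (1 + ε) * normInChart F.norm φ z (q - p) := by
      intro t ht
      have hm := hball (hlb t (Ioc_subset_Icc_self ht))
      have h1 : F.speed (φ.symm ∘ l) t = normInChart F.norm φ (φ.symm (l t)) (q - p) := by
        have hmd : MDifferentiableAt 𝓘(ℝ, X) 𝓘(ℝ, X) φ.symm (l t) :=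
          (contMDiffOn_symm_of_mem_maximalAtlas hφ |>.contMDiffAt
            (φ.open_target.mem_nhds hm.1)).mdifferentiableAt one_ne_zero
        unfold speed normInChart
        rw [φ.right_inv hm.1, mfderiv_comp t hmd (hld t).differentiableAt.mdifferentiableAt,
          mfderiv_eq_fderiv]
        have h2 : (fderiv ℝ l t : ℝ →L[ℝ] X) 1 = q - p := by simp [(hld t).deriv]
        exact congrArg (fun v : X => F.norm (φ.symm (l t))
          (mfderiv 𝓘(ℝ, X) 𝓘(ℝ, X) φ.symm (l t) v)) h2
      rw [Real.norm_of_nonneg (F.speed_nonneg _ _), h1]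
      exact (hWb _ hm.2 _).2
    have h := intervalIntegral.norm_integral_le_of_norm_le_const (a := (0 : ℝ)) (b := 1)
      (f := F.speed (φ.symm ∘ l)) (by simpa [uIoc_of_le zero_le_one] using hsp)
    rw [length_eq]
    simpa using (le_abs_self _).trans h

end FinslerStructure

/-! ### Almost maximal points without compactness -/

/-- Ekeland's variational principle, for a function that is bounded above on a set `S` which is
sequentially complete for a distance-like function `d`. -/
theorem exists_ekeland_point {α : Type*} {d : α → α → ℝ} (d_nonneg : ∀ x y, 0 ≤ d x y)
    (d_self : ∀ x, d x x = 0) (d_comm : ∀ x y, d x y = d y x)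
    (d_tri : ∀ x y z, d x z ≤ d x y + d y z) {S : Set α} {u : α → ℝ} {B : ℝ}
    (hB : ∀ x ∈ S, u x ≤ B)
    (hcomplete : ∀ p : ℕ → α, (∀ n, p n ∈ S) →
      (∀ ε : ℝ, 0 < ε → ∃ n₀ : ℕ, ∀ m ≥ n₀, ∀ n ≥ n₀, d (p m) (p n) < ε) →
      ∃ x ∈ S, Tendsto (fun n => d (p n) x) atTop (𝓝 0) ∧
        Tendsto (fun n => u (p n)) atTop (𝓝 (u x)))
    {ε : ℝ} (hε : 0 < ε) {x₀ : α} (hx₀ : x₀ ∈ S) :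
    ∃ z ∈ S, u x₀ ≤ u z ∧ ∀ y ∈ S, u y ≤ u z + ε * d z y := by
  -- `A x` holds the points whose gain in `u` pays for the distance from `x`. Each iterate nearly
  -- maximizes `u` on the `A` of its predecessor.
  set A : α → Set α := fun x => {y | y ∈ S ∧ u x + ε * d x y ≤ u y} with hA
  have hAb : ∀ x, BddAbove (u '' A x) := fun x => ⟨B, by
    rintro _ ⟨y, hy, rfl⟩; exact hB y hy.1⟩
  have hstep : ∀ (n : ℕ) (x : S), ∃ y : S, (y : α) ∈ A x ∧
      ∀ w ∈ A x, u w ≤ u y + (1 / 2) ^ n := by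
    intro n x
    have hne : (u '' A x).Nonempty := ⟨_, x, ⟨x.2, by simp [d_self]⟩, rfl⟩
    obtain ⟨_, ⟨y, hy, rfl⟩, hlt⟩ := exists_lt_of_lt_csSup hne
      (sub_lt_self (sSup (u '' A x)) (by positivity : (0 : ℝ) < (1 / 2) ^ n))
    refine ⟨⟨y, hy.1⟩, hy, fun w hw => ?_⟩
    have := le_csSup (hAb x) (mem_image_of_mem u hw)
    change u w ≤ u y + _
    linarith
  choose f hfA hf using hstep
  set p : ℕ → S := fun n => Nat.rec ⟨x₀, hx₀⟩ (fun n x => f n x) n with hp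
  have hps : ∀ n, p (n + 1) = f n (p n) := fun n => rfl
  -- The gains telescope, so bounded monotone values of `u` force the iterates to be Cauchy.
  have hle : ∀ m k, u (p m) + ε * d (p m) (p (m + k)) ≤ u (p (m + k)) := by
    intro m k
    induction k with
    | zero => simp [d_self]
    | succ k ih =>
      have h1 := (hfA (m + k) (p (m + k))).2
      rw [← hps] at h1
      have h2 := mul_le_mul_of_nonneg_left (d_tri (p m) (p (m + k)) (p (m + k + 1))) hε.le
      rw [← add_assoc]
      linarith
  have hmono : Monotone fun n => u (p n) := monotone_nat_of_le_succ fun n => by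
    have := hle n 1
    have := mul_nonneg hε.le (d_nonneg (p n) (p (n + 1)))
    linarith
  have hbd : BddAbove (range fun n => u (p n)) := ⟨B, by
    rintro _ ⟨n, rfl⟩; exact hB _ (p n).2⟩
  have hlim := tendsto_atTop_ciSup hmono hbd
  set l := ⨆ n, u (p n)
  have hul : ∀ n, u (p n) ≤ l := fun n => le_ciSup hbd n
  obtain ⟨z, hz, hzd, hzu⟩ := hcomplete (fun n => p n) (fun n => (p n).2) (by
    intro δ hδ
    obtain ⟨n₀, hn₀⟩ := (hlim.eventually_const_lt
      (sub_lt_self l (by positivity : 0 < ε * δ))).exists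
    have key : ∀ m ≥ n₀, ∀ n ≥ m, d (p m) (p n) < δ := by
      intro m hm n hn
      obtain ⟨k, rfl⟩ := Nat.exists_eq_add_of_le hn
      have h1 := hle m k
      have h2 := hul (m + k)
      have h3 : u (p n₀) ≤ u (p m) := hmono hm
      exact lt_of_mul_lt_mul_left (by linarith) hε.le
    refine ⟨n₀, fun m hm n hn => ?_⟩
    rcases le_total m n with h | h
    · exact key m hm n h
    · rw [d_comm]; exact key n hn m h)
  have hzl : u z = l := tendsto_nhds_unique hzu hlim
  have hpz : ∀ m, u (p m) + ε * d (p m) z ≤ u z := by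
    intro m
    have h1 : Tendsto (fun n => u (p m) + ε * (d (p m) z - d (p n) z)) atTop
        (𝓝 (u (p m) + ε * (d (p m) z - 0))) :=
      ((tendsto_const_nhds.sub hzd).const_mul ε).const_add _
    rw [sub_zero] at h1
    refine le_of_tendsto_of_tendsto h1 hzu ?_
    filter_upwards [eventually_ge_atTop m] with n hn
    obtain ⟨k, rfl⟩ := Nat.exists_eq_add_of_le hn
    have h2 := hle m k
    have h3 := mul_le_mul_of_nonneg_left
      (show d (p m) z - d (p (m + k)) z ≤ d (p m) (p (m + k)) by
        linarith [d_tri (p m) (p (m + k)) z]) hε.le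
    linarith
  refine ⟨z, hz, hzl ▸ hul 0, fun y hy => ?_⟩
  by_contra! hlt
  -- A violating `y` competes at every stage, so near-maximality gives `u y ≤ u z` in the limit.
  have hyA : ∀ n, y ∈ A (p n) := fun n => ⟨hy, by
    have h1 := hpz n
    have h2 := mul_le_mul_of_nonneg_left (d_tri (p n) z y) hε.le
    linarith⟩
  have h1 : Tendsto (fun n : ℕ => u (p (n + 1)) + (1 / 2 : ℝ) ^ n) atTop (𝓝 (u z + 0)) :=
    ((tendsto_add_atTop_iff_nat 1).2 hzu).add
      (tendsto_pow_atTop_nhds_zero_of_lt_one (by norm_num) (by norm_num))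
  have h2 : u y ≤ u z + 0 := ge_of_tendsto' h1 fun n => hf n (p n) y (hyA n)
  have := mul_nonneg hε.le (d_nonneg z y)
  linarith

/-! ### Distance versus topology; first-order estimates -/

namespace FinslerStructure

variable {X : Type*} [NormedAddCommGroup X] [NormedSpace ℝ X]
  {M : Type*} [TopologicalSpace M] [ChartedSpace X M] [IsManifold 𝓘(ℝ, X) 1 M]
  (F : FinslerStructure X M)

theorem eventually_hasPath (z : M) : ∀ᶠ y in 𝓝 z, ∃ L, F.HasPath z y L := by
  obtain ⟨r, hr, -, h⟩ := F.exists_hasArc_chart (IsManifold.chart_mem_maximalAtlas z)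
    (mem_chart_source X z) one_pos
  filter_upwards [(chartAt X z).open_source.mem_nhds (mem_chart_source X z),
    ((chartAt X z).continuousAt (mem_chart_source X z)).preimage_mem_nhds
      (Metric.ball_mem_nhds _ hr)] with y hy hyr
  obtain ⟨L, hL, -⟩ := h _ (Metric.mem_ball_self hr) _ hyr
  rw [(chartAt X z).left_inv (mem_chart_source X z), (chartAt X z).left_inv hy] at hL
  exact ⟨L, hL.hasPath F⟩

/-- The set reachable from `p` is clopen. This keeps the infimum defining `dist` from being over an
empty set. -/
theorem exists_hasPath [ConnectedSpace M] (p q : M) : ∃ L, F.HasPath p q L := by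
  have hclopen : IsClopen {y | ∃ L, F.HasPath p y L} := by
    constructor
    · rw [← isOpen_compl_iff, isOpen_iff_mem_nhds]
      intro z hz
      filter_upwards [F.eventually_hasPath z] with y ⟨L, hL⟩
      rintro ⟨L', hL'⟩
      exact hz ⟨_, hL'.trans F (hL.symm F)⟩
    · rw [isOpen_iff_mem_nhds]
      rintro z ⟨L', hL'⟩
      filter_upwards [F.eventually_hasPath z] with y ⟨L, hL⟩
      exact ⟨_, hL'.trans F hL⟩
  have h : q ∈ {y | ∃ L, F.HasPath p y L} :=
    hclopen.eq_univ ⟨p, 0, HasPath.refl F p⟩ ▸ mem_univ q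
  exact h

theorem exists_hasPath_lt [ConnectedSpace M] {p q : M} {r : ℝ} (h : F.dist p q < r) :
    ∃ L < r, F.HasPath p q L := by
  obtain ⟨L, hL, hlt⟩ := exists_lt_of_csInf_lt (F.exists_hasPath p q) h
  exact ⟨L, hlt, hL⟩

theorem dist_triangle [ConnectedSpace M] (p q r : M) :
    F.dist p r ≤ F.dist p q + F.dist q r := by
  refine le_of_forall_pos_le_add fun ε hε => ?_
  obtain ⟨L, hL, h⟩ := F.exists_hasPath_lt (show F.dist p q < F.dist p q + ε / 2 by linarith)
  obtain ⟨L', hL', h'⟩ := F.exists_hasPath_lt (show F.dist q r < F.dist q r + ε / 2 by linarith)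
  have := F.dist_le_of_hasPath (h.trans F h')
  linarith

/-- The Finsler balls form a basis of neighborhoods finer than the topology of the manifold. -/
theorem exists_dist_lt_imp_mem [RegularSpace M] [ConnectedSpace M] {z : M} {V : Set M}
    (hV : V ∈ 𝓝 z) : ∃ δ > 0, ∀ y, F.dist z y < δ → y ∈ V := by
  set φ := chartAt X z
  have hφ : φ ∈ IsManifold.maximalAtlas 𝓘(ℝ, X) 1 M := IsManifold.chart_mem_maximalAtlas z
  have hz : z ∈ φ.source := mem_chart_source X z
  obtain ⟨W, hW, hzW, hWs, hWb⟩ := F.palais φ hφ z hz 1 one_pos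
  obtain ⟨K, hK, hKb⟩ := F.equivalent φ hφ z hz
  -- A closed `N` keeps the closure of `U` inside the chart domain, so an exit point still has
  -- coordinates.
  obtain ⟨N, hN, hNc, hNs⟩ := exists_mem_nhds_isClosed_subset (inter_mem hV (hW.mem_nhds hzW))
  have hn : φ.target ∩ φ.symm ⁻¹' N ∈ 𝓝 (φ z) :=
    inter_mem (φ.open_target.mem_nhds (φ.map_source hz))
      ((φ.symm.continuousAt (φ.map_source hz)).preimage_mem_nhds (by rwa [φ.left_inv hz]))
  obtain ⟨r, hr, hball⟩ := Metric.mem_nhds_iff.1 hn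
  set U := φ.source ∩ φ ⁻¹' Metric.ball (φ z) r
  have hU : IsOpen U := φ.isOpen_inter_preimage Metric.isOpen_ball
  have hzU : z ∈ U := ⟨hz, Metric.mem_ball_self hr⟩
  have hUN : U ⊆ N := fun x hx => by
    have := (hball hx.2).2
    rwa [mem_preimage, φ.left_inv hx.1] at this
  have hcl : closure U ⊆ φ.source := fun x hx =>
    hWs (hNs (closure_minimal hUN hNc hx)).2
  -- `K` comes from norm equivalence at `z`, and 2 from the Palais condition with `ε = 1`.
  have hC : 0 < 2 * K := by linarith
  have hb : ∀ x ∈ U, ∀ ξ : TangentSpace 𝓘(ℝ, X) x,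
      Norm.norm (E := X) (mfderiv 𝓘(ℝ, X) 𝓘(ℝ, X) φ x ξ) ≤ 2 * K * F.norm x ξ := by
    intro x hx ξ
    rw [← F.norm_eq_normInChart hφ hx.1 ξ]
    have h1 := (hKb (mfderiv 𝓘(ℝ, X) 𝓘(ℝ, X) φ x ξ)).1
    have h2 := (hWb x (hNs (hUN hx)).2 (mfderiv 𝓘(ℝ, X) 𝓘(ℝ, X) φ x ξ)).1
    rw [one_div_mul_eq_div, div_le_iff₀ (by linarith)] at h1 h2
    have h3 := mul_le_mul_of_nonneg_right h2 (by linarith : 0 ≤ K)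
    refine h1.trans (h3.trans (le_of_eq ?_))
    ring
  refine ⟨r / (2 * K), by positivity, fun y hy => ?_⟩
  by_contra hyV
  obtain ⟨L, hL, hpath⟩ := F.exists_hasPath_lt hy
  obtain ⟨w, hw, hwL⟩ := hpath.exists_mem_frontier F hU (f := φ) (C := 2 * K)
    (φ.continuousOn.mono hcl)
    (fun x hx => ((contMDiffOn_of_mem_maximalAtlas hφ).contMDiffAt
      (φ.open_source.mem_nhds hx.1)).mdifferentiableAt one_ne_zero) hC.le hb hzU
    (fun h => hyV (hNs (hUN h)).1)
  have h1 : w ∉ U := by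
    have := hw.2
    rwa [hU.interior_eq] at this
  have h2 : ¬ φ w ∈ Metric.ball (φ z) r := fun h => h1 ⟨hcl hw.1, h⟩
  rw [Metric.mem_ball, dist_eq_norm, not_lt] at h2
  rw [lt_div_iff₀ hC] at hL
  linarith

theorem tendsto_of_tendsto_dist [RegularSpace M] [ConnectedSpace M] {p : ℕ → M} {x : M}
    (h : Tendsto (fun n => F.dist (p n) x) atTop (𝓝 0)) : Tendsto p atTop (𝓝 x) := by
  refine tendsto_def.2 fun V hV => ?_
  obtain ⟨δ, hδ, hb⟩ := F.exists_dist_lt_imp_mem hV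
  filter_upwards [Tendsto.eventually_lt_const hδ h] with n hn
  exact hb _ (F.dist_comm x (p n) ▸ hn)

/-- The supremum of an unbounded set is 0 by convention, so the value 1 already forces boundedness.
-/
theorem abs_apply_le_of_dualNorm_eq_one {x : M} {Δ : TangentSpace 𝓘(ℝ, X) x →L[ℝ] ℝ}
    (h : F.dualNorm x Δ = 1) (ξ : TangentSpace 𝓘(ℝ, X) x) : |Δ ξ| ≤ F.norm x ξ := by
  rcases (apply_nonneg (F.norm x) ξ).eq_or_lt with h0 | hpos
  · rw [F.eq_zero_of_norm x ξ h0.symm]; simp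
  have hbdd : BddAbove {r : ℝ | ∃ ξ : TangentSpace 𝓘(ℝ, X) x, F.norm x ξ = 1 ∧ r = |Δ ξ|} := by
    by_contra hn
    have := Real.sSup_of_not_bddAbove hn
    unfold dualNorm at h
    linarith
  have h1 : |Δ ((F.norm x ξ)⁻¹ • ξ)| ≤ 1 := by
    rw [← h]
    refine le_csSup hbdd ⟨_, ?_, rfl⟩
    rw [map_smul_eq_mul, norm_inv, Real.norm_of_nonneg hpos.le, inv_mul_cancel₀ hpos.ne']
  rwa [map_smul, smul_eq_mul, abs_mul, abs_inv, abs_of_pos hpos, inv_mul_le_iff₀ hpos,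
    mul_one] at h1

/-- A one-sided bound suffices, as `ξ` may be replaced by `-ξ`. -/
theorem dualNorm_le {x : M} {Δ : TangentSpace 𝓘(ℝ, X) x →L[ℝ] ℝ} {C : ℝ} (hC : 0 ≤ C)
    (h : ∀ ξ, Δ ξ ≤ C * F.norm x ξ) : F.dualNorm x Δ ≤ C := by
  refine Real.sSup_le ?_ hC
  rintro _ ⟨ξ, hξ, rfl⟩
  rw [abs_le]
  have h1 := h ξ
  have h2 := h (-ξ)
  rw [map_neg, map_neg_eq_map, hξ] at h2
  rw [hξ] at h1
  constructor <;> linarith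

theorem normInChart_smul (φ : OpenPartialHomeomorph M X) (x : M) {t : ℝ} (ht : 0 ≤ t) (v : X) :
    normInChart F.norm φ x (t • v) = t * normInChart F.norm φ x v := by
  unfold normInChart
  refine (congrArg _ (ContinuousLinearMap.map_smul _ t v)).trans ?_
  refine (map_smul_eq_mul _ _ _).trans ?_
  rw [Real.norm_of_nonneg ht]
  rfl

/-- A function whose increments at `z` are at most `ε` times the distance has slope less than
`ε (1 + η)` at `z`. -/
theorem mfderiv_apply_le {u : M → ℝ} {z : M} {ε η : ℝ} (hε : 0 ≤ ε) (hη : 0 < η)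
    (hu : MDifferentiableAt 𝓘(ℝ, X) 𝓘(ℝ, ℝ) u z)
    (h : ∀ᶠ y in 𝓝 z, u y ≤ u z + ε * F.dist z y) (ξ : TangentSpace 𝓘(ℝ, X) z) :
    LE.le (α := ℝ) (mfderiv 𝓘(ℝ, X) 𝓘(ℝ, ℝ) u z ξ) (ε * (1 + η) * F.norm z ξ) := by
  set φ := chartAt X z
  have hφ : φ ∈ IsManifold.maximalAtlas 𝓘(ℝ, X) 1 M := IsManifold.chart_mem_maximalAtlas z
  have hz : z ∈ φ.source := mem_chart_source X z
  have hmd : φ.MDifferentiable 𝓘(ℝ, X) 𝓘(ℝ, X) := mdifferentiable_chart z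
  obtain ⟨r, hr, hrt, harc⟩ := F.exists_hasArc_chart hφ hz hη
  set w : X := mfderiv 𝓘(ℝ, X) 𝓘(ℝ, X) φ z ξ
  set l : ℝ → X := fun t => φ z + t • w with hl
  have hl0 : l 0 = φ z := by simp [hl]
  have hld : HasDerivAt l w 0 := by
    simpa [hl] using ((hasDerivAt_id (0 : ℝ)).smul_const w).const_add (φ z)
  have hψ : HasMFDerivAt 𝓘(ℝ, X) 𝓘(ℝ, X) φ.symm (l 0)
      (mfderiv 𝓘(ℝ, X) 𝓘(ℝ, X) φ.symm (l 0)) :=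
    (hmd.mdifferentiableAt_symm (hl0 ▸ φ.map_source hz)).hasMFDerivAt
  have hψ0 : φ.symm (l 0) = z := by rw [hl0, φ.left_inv hz]
  have hderiv : HasDerivAt (fun t => u (φ.symm (l t)))
      (mfderiv 𝓘(ℝ, X) 𝓘(ℝ, ℝ) u z ξ) 0 := by
    have h1 := hψ.comp (0 : ℝ) hld.hasFDerivAt.hasMFDerivAt
    have hu' : HasMFDerivAt 𝓘(ℝ, X) 𝓘(ℝ, ℝ) u ((φ.symm ∘ l) 0)
        (mfderiv 𝓘(ℝ, X) 𝓘(ℝ, ℝ) u z) := by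
      have : (φ.symm ∘ l) 0 = z := hψ0
      rw [this]; exact hu.hasMFDerivAt
    let A : X →L[ℝ] ℝ := mfderiv 𝓘(ℝ, X) 𝓘(ℝ, ℝ) u z
    let D : X →L[ℝ] X := mfderiv 𝓘(ℝ, X) 𝓘(ℝ, X) φ.symm (l 0)
    have h2 : HasFDerivAt (fun t => u (φ.symm (l t)))
        (A.comp (D.comp (ContinuousLinearMap.toSpanSingleton ℝ w))) 0 :=
      (hu'.comp (0 : ℝ) h1).hasFDerivAt
    have h3 : D w = ξ := by
      have := DFunLike.congr_fun (hmd.symm_comp_deriv hz) ξ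
      rw [← hl0] at this
      exact this
    have h4 := h2.hasDerivAt
    simp only [ContinuousLinearMap.comp_apply, ContinuousLinearMap.toSpanSingleton_apply, one_smul,
      h3] at h4
    exact h4
  refine le_of_tendsto hderiv.tendsto_slope_zero_right ?_
  have hlc : Tendsto l (𝓝[>] 0) (𝓝 (φ z)) := by
    have := hld.continuousAt.tendsto
    rw [hl0] at this
    exact this.mono_left nhdsWithin_le_nhds
  have hlu : Tendsto (fun t => φ.symm (l t)) (𝓝[>] 0) (𝓝 z) := by
    have := (φ.symm.continuousAt (φ.map_source hz)).tendsto.comp hlc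
    rwa [φ.left_inv hz] at this
  filter_upwards [self_mem_nhdsWithin, hlc.eventually (Metric.ball_mem_nhds _ hr),
    hlu.eventually h] with t ht htr htu
  rw [zero_add, smul_eq_mul, inv_mul_le_iff₀ ht, hψ0]
  obtain ⟨L, hL, hLb⟩ := harc _ (Metric.mem_ball_self hr) _ htr
  rw [φ.left_inv hz] at hL
  have h1 := mul_le_mul_of_nonneg_left
    ((F.dist_le_of_hasPath (hL.hasPath F)).trans hLb) hε
  have h2 : l t - φ z = t • w := by simp [hl]
  rw [h2, F.normInChart_smul φ z (le_of_lt ht), F.norm_eq_normInChart hφ hz] at h1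
  linarith

/-! ### Bounds and sign of eikonal solutions -/

theorem IsClassicalEikonalSolution.neg {Ω : Set M} {u : M → ℝ}
    (h : F.IsClassicalEikonalSolution Ω u) : F.IsClassicalEikonalSolution Ω (-u) where
  continuousOn := h.continuousOn.neg
  differentiable x hx := (h.differentiable x hx).neg
  eikonal x hx := by
    rw [← h.eikonal x hx]
    unfold dualNorm
    congr 1
    ext r
    refine exists_congr fun ξ => and_congr_right fun _ => ?_
    rw [mfderiv_neg]
    have : ∀ (Δ : X →L[ℝ] ℝ) (v : X), |(-Δ) v| = |Δ v| := fun Δ v => by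
      rw [neg_apply, abs_neg]
    exact Eq.congr_right (this _ ξ)
  boundary x hx := by simp [h.boundary x hx]

/-- A classical solution of the eikonal problem on a bounded open set is bounded. -/
theorem IsClassicalEikonalSolution.exists_bound [ConnectedSpace M] {Ω : Set M} (hΩ : IsOpen Ω)
    (hne : Ω.Nonempty) (hbdd : F.IsBoundedSet Ω) (hfr : (frontier Ω).Nonempty) {u : M → ℝ}
    (h : F.IsClassicalEikonalSolution Ω u) : ∃ B, ∀ x ∈ closure Ω, u x ≤ B := by
  obtain ⟨R, hR⟩ := hbdd
  obtain ⟨x₀, hx₀⟩ := hne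
  obtain ⟨y, hy⟩ := hfr
  have hy' : y ∉ Ω := by
    have := hy.2
    rwa [hΩ.interior_eq] at this
  -- The 1 is slack for a nearly shortest path to `y`; the 0 covers frontier points.
  refine ⟨max 0 (R + F.dist x₀ y + 1), fun x hx => ?_⟩
  by_cases hxΩ : x ∈ Ω
  · obtain ⟨L, hL, hpath⟩ := F.exists_hasPath_lt (lt_add_one (F.dist x y))
    obtain ⟨w, hw, hwL⟩ := hpath.exists_mem_frontier F hΩ (f := u) (C := 1) h.continuousOn
      h.differentiable zero_le_one (fun x hx ξ => by
        rw [one_mul]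
        exact F.abs_apply_le_of_dualNorm_eq_one (h.eikonal x hx) ξ) hxΩ hy'
    rw [h.boundary w hw, zero_sub, norm_neg, Real.norm_eq_abs, one_mul] at hwL
    have h1 := F.dist_triangle x x₀ y
    have h2 := hR x hxΩ x₀ hx₀
    have h3 := le_abs_self (u x)
    exact le_max_of_le_right (by linarith)
  · rw [h.boundary x ⟨hx, by rwa [hΩ.interior_eq]⟩]
    exact le_max_left _ _

/-- On a complete manifold a classical solution of the eikonal problem is nonpositive. -/
theorem IsClassicalEikonalSolution.nonpos [RegularSpace M] [ConnectedSpace M]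
    (hF : F.IsCompleteMetric) {Ω : Set M} (hΩ : IsOpen Ω) (hbdd : F.IsBoundedSet Ω)
    (hfr : (frontier Ω).Nonempty) {u : M → ℝ} (h : F.IsClassicalEikonalSolution Ω u)
    {x : M} (hx : x ∈ Ω) : u x ≤ 0 := by
  by_contra! hpos
  obtain ⟨B, hB⟩ := h.exists_bound F hΩ ⟨x, hx⟩ hbdd hfr
  obtain ⟨z, hz, hxz, hmax⟩ := exists_ekeland_point (d := F.dist) F.dist_nonneg F.dist_self
    F.dist_comm F.dist_triangle hB (fun p hp hcauchy => by
      obtain ⟨y, hy⟩ := hF p hcauchy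
      have hpy := F.tendsto_of_tendsto_dist hy
      have hyc : y ∈ closure Ω := isClosed_closure.mem_of_tendsto hpy (Eventually.of_forall hp)
      refine ⟨y, hyc, hy, (h.continuousOn y hyc).tendsto.comp ?_⟩
      exact tendsto_nhdsWithin_iff.2 ⟨hpy, Eventually.of_forall hp⟩)
    (half_pos one_pos) (subset_closure hx)
  have hzΩ : z ∈ Ω := by
    by_contra hn
    have := h.boundary z ⟨hz, by rwa [hΩ.interior_eq]⟩
    linarith
  -- Any `ε` and `η` with `ε * (1 + η) < 1` would do; here the product is 3/4.
  have hle := F.dualNorm_le (Δ := mfderiv 𝓘(ℝ, X) 𝓘(ℝ, ℝ) u z)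
    (by norm_num : (0 : ℝ) ≤ 1 / 2 * (1 + 1 / 2))
    (F.mfderiv_apply_le (ε := 1 / 2) (η := 1 / 2) (by norm_num) (by norm_num) (h.differentiable z hzΩ) (by
      filter_upwards [hΩ.mem_nhds hzΩ] with y hy using hmax y (subset_closure hy)))
  have h1 : F.dualNorm z (mfderiv 𝓘(ℝ, X) 𝓘(ℝ, ℝ) u z) = 1 := h.eikonal z hzΩ
  rw [h1] at hle
  norm_num at hle

end FinslerStructure

theorem mainTheorem7
    {X : Type*} [NormedAddCommGroup X] [NormedSpace ℝ X] [CompleteSpace X]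
    (hX : HasC1LipschitzBump X)
    {M : Type*} [TopologicalSpace M] [T2Space M] [ParacompactSpace M] [ConnectedSpace M]
    [ChartedSpace X M] [IsManifold 𝓘(ℝ, X) 1 M]
    (F : FinslerStructure X M) (hF : F.IsCompleteMetric)
    (Ω : Set M) (hΩ : IsOpen Ω) (hne : Ω.Nonempty) (hbdd : F.IsBoundedSet Ω)
    (hfr : (frontier Ω).Nonempty) :
    ¬ ∃ u : M → ℝ, F.IsClassicalEikonalSolution Ω u := by
  rintro ⟨u, hu⟩
  obtain ⟨x, hx⟩ := hne
  have hu0 : ∀ y ∈ Ω, u y = 0 := fun y hy => le_antisymm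
    (hu.nonpos F hF hΩ hbdd hfr hy)
    (neg_nonpos.1 ((hu.neg F).nonpos F hF hΩ hbdd hfr hy))
  -- Since `u` is constant on `Ω`, the slope estimate applies with `ε = 0`.
  have hle := F.dualNorm_le (Δ := mfderiv 𝓘(ℝ, X) 𝓘(ℝ, ℝ) u x)
    (by norm_num : (0 : ℝ) ≤ 0 * (1 + 1))
    (F.mfderiv_apply_le le_rfl one_pos (hu.differentiable x hx) (by
      filter_upwards [hΩ.mem_nhds hx] with y hy
      rw [hu0 y hy, hu0 x hx, zero_mul, zero_add]))
  have h1 : F.dualNorm x (mfderiv 𝓘(ℝ, X) 𝓘(ℝ, ℝ) u x) = 1 := hu.eikonal x hx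
  rw [h1] at hle
  norm_num at hle
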